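/- Let $R$ be a commutative ring with $1$ in which $2$ is invertible ($R=2R$), let $I$ be an ideal of $R$, and let $n\ge 2$. Let $\widetilde\psi_m=\sum_{i=1}^m (e_{2i-1,2i}+e_{2i,2i-1})$ be the standard symmetric $2m\times 2m$ matrix. Let $P$ be a free $R$-module of rank $2n$ with a non-degenerate symmetric bilinear form $\langle\,,\rangle$ (that is, $P\to P^*$, $p\mapsto\langle p,\cdot\rangle$, is an isomorphism) whose Gram matrix $\varphi$ with respect to some basis of $P$ satisfies $\varphi=\varepsilon^t\,\widetilde\psi_n\,\varepsilon$ for some $\varepsilon\in \mathrm{GL}_{2n}(R)$. Let $Q=\mathbb H(R)\oplus P=R^2\oplus P$ with the form $$\langle (a_1,b_1,p_1),(a_2,b_2,p_2)\rangle=a_1b_2+b_1a_2+\langle p_1,p_2\rangle .$$ Define the following groups of isometries of $Q$. * $\mathrm{Trans}_{\mathrm O}(Q,IQ)$ is the group generated by the maps $x\mapsto x-\langle u,x\rangle v+\langle v,x\rangle u$, where $u,v\in Q$ satisfy $\langle u,u\rangle=\langle v,v\rangle=\langle u,v\rangle=0$, at least one of $u,v$ is unimodular (some linear form $Q\to R$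 takes the value $1$ on it), and $u\in IQ$ or $v\in IQ$. * For $q\in P$ with $\langle q,q\rangle=0$ put $\rho(q)(a,b,p)=(a,\,b+\langle p,q\rangle,\,p-aq)$ and $\mu(q)(a,b,p)=(a+\langle p,q\rangle,\,b,\,p-bq)$. $\mathrm{ETrans}_{\mathrm O}(Q)$ is the group generated by all $\rho(q),\mu(q)$ with $q \in P$ isotropic; $\mathrm{ETrans}_{\mathrm O}(IQ)$ is its subgroup generated by those with $q\in IP$; and $\mathrm{ETrans}_{\mathrm O}(Q,IQ)$ is the normal closure of $\mathrm{ETrans}_{\mathrm O}(IQ)$ in $\mathrm{ETrans}_{\mathrm O}(Q)$. Let $\mathrm O_{2m}(R)=\{\alpha\in \mathrm{GL}_{2m}(R):\alpha^t\widetilde\psi_m\alpha=\widetilde\psi_m\}$, and let $\sigma$ be the permutation of $\{1,\dots,2m\}$ interchanging $2i-1$ and $2i$ for each $i$. Let $\mathrm{EO}_{2m}(R)$ be the subgroup of $\mathrm O_{2m}(R)$ generated by the matrices $oe_{ij}(z)=1_{2m}+ze_{ij}-ze_{\sigma(j)\sigma(i)}$ with $z\in R$, $i\ne j$, $i\neq\sigma(j)$;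 let $\mathrm{EO}_{2m}(I)$ be its subgroup generated by those with $z\in I$; and let $\mathrm{EO}_{2m}(R,I)$ be the normal closure of $\mathrm{EO}_{2m}(I)$ in $\mathrm{EO}_{2m}(R)$. Then $$\mathrm{Trans}_{\mathrm O}(Q,IQ)=\mathrm{ETrans}_{\mathrm O}(Q,IQ).$$ Moreover, when automorphisms of $Q$ are written as matrices acting on coordinate columns with respect to the basis consisting of $(1,0,0)$, $(0,1,0)$ and the given basis of $P$, both groups are equal to $$(I_2\perp\varepsilon)^{-1}\;\mathrm{EO}_{2n+2}(R,I)\;(I_2\perp\varepsilon).$$ -/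

import Mathlib

open Matrix Module

namespace RelOrth

/-! ### Group theory and modules -/

/-- The normal closure of the subgroup `H` in the subgroup `K`
(used with `H` contained in `K`), as a subgroup of the ambient group. -/
def normalClosureIn {G : Type*} [Group G] (H K : Subgroup G) : Subgroup G :=
  (Subgroup.normalClosure (H.subgroupOf K : Set K)).map K.subtype

section Forms

variable {R : Type*} [CommRing R] {M : Type*} [AddCommGroup M] [Module R M]

/-- `p` is unimodular if some linear form takes the value `1` at `p`. -/
def IsUnimodular (R : Type*) [CommRing R] {M : Type*} [AddCommGroup M] [Module R M]
    (p : M) : Prop :=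
  ∃ f : M →ₗ[R] R, f p = 1

/-- A symmetric inner product: a symmetric bilinear form whose natural map `M → M*` is an
isomorphism. -/
structure IsSymmInnerProduct (B : LinearMap.BilinForm R M) : Prop where
  symm : ∀ x y : M, B x y = B y x
  nondegenerate : Function.Bijective (fun x : M => (B x : M →ₗ[R] R))

/-- The group `O(M)` of isometries of `(M, B)`. -/
def isometryGroup (B : LinearMap.BilinForm R M) : Subgroup (M ≃ₗ[R] M) where
  carrier := {τ | ∀ x y : M, B (τ x) (τ y) = B x y}
  mul_mem' := by
    intro a b ha hb x y
    exact (ha (b x) (b y)).trans (hb x y)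
  one_mem' := by
    intro x y
    rfl
  inv_mem' := by
    intro a ha x y
    have h := ha (a⁻¹ x) (a⁻¹ y)
    have e : ∀ z : M, a (a⁻¹ z) = z := fun z => a.apply_symm_apply z
    rw [e, e] at h
    exact h.symm

/-- `u, v` are isotropic and orthogonal, and `u` or `v` is unimodular. -/
structure IsTransvectionPair (B : LinearMap.BilinForm R M) (u v : M) : Prop where
  isotropic_left : B u u = 0
  isotropic_right : B v v = 0
  orthogonal : B u v = 0
  unimodular : IsUnimodular R u ∨ IsUnimodular R v

/-- `Trans_O(M, IM)`: the subgroup of `O(M)` generated by the orthogonal transvections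
`p ↦ p - ⟨u, p⟩ v + ⟨v, p⟩ u` with `u ∈ IM` or `v ∈ IM`. -/
def relTransO (B : LinearMap.BilinForm R M) (I : Ideal R) : Subgroup (isometryGroup B) :=
  Subgroup.closure {τ | ∃ u v : M, IsTransvectionPair B u v ∧
    (u ∈ I • (⊤ : Submodule R M) ∨ v ∈ I • (⊤ : Submodule R M)) ∧
    ∀ p : M, (τ : M ≃ₗ[R] M) p = p - B u p • v + B v p • u}

end Forms

section Hyperbolic

variable {R : Type*} [CommRing R] {P : Type*} [AddCommGroup P] [Module R P]

/-- The form of the hyperbolic plane `ℍ(R) = R ⊕ R*`, with `R*` identified with `R` by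
`f ↦ f 1`: `⟨(a₁, b₁), (a₂, b₂)⟩ = b₂ a₁ + b₁ a₂`. -/
def hypPlane (R : Type*) [CommRing R] : LinearMap.BilinForm R (R × R) :=
  LinearMap.mk₂ R (fun x y => y.2 * x.1 + x.2 * y.1)
    (by intro x x' y; simp only [Prod.fst_add, Prod.snd_add]; ring)
    (by intro c x y; simp only [Prod.smul_fst, Prod.smul_snd, smul_eq_mul]; ring)
    (by intro x y y'; simp only [Prod.fst_add, Prod.snd_add]; ring)
    (by intro c x y; simp only [Prod.smul_fst, Prod.smul_snd, smul_eq_mul]; ring)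

/-- The orthogonal sum of two bilinear forms. -/
def orthSum {M N : Type*} [AddCommGroup M] [Module R M] [AddCommGroup N] [Module R N]
    (B : LinearMap.BilinForm R M) (C : LinearMap.BilinForm R N) :
    LinearMap.BilinForm R (M × N) :=
  B.compl₁₂ (LinearMap.fst R M N) (LinearMap.fst R M N) +
    C.compl₁₂ (LinearMap.snd R M N) (LinearMap.snd R M N)

/-- The form of `Q = ℍ(R) ⊕ P` on the module `R² ⊕ P`. -/
abbrev formQ (B : LinearMap.BilinForm R P) : LinearMap.BilinForm R ((R × R) × P) :=
  orthSum (hypPlane R) B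

/-- `τ` is `ρ(q) : (a, b, p) ↦ (a, b + ⟨p, q⟩, p - a q)`. -/
def IsRho (B : LinearMap.BilinForm R P) (q : P) (τ : isometryGroup (formQ B)) : Prop :=
  ∀ (a b : R) (p : P),
    (τ : ((R × R) × P) ≃ₗ[R] ((R × R) × P)) ((a, b), p) = ((a, b + B p q), p - a • q)

/-- `τ` is `μ(q) : (a, b, p) ↦ (a + ⟨p, q⟩, b, p - b q)`. -/
def IsMu (B : LinearMap.BilinForm R P) (q : P) (τ : isometryGroup (formQ B)) : Prop :=
  ∀ (a b : R) (p : P),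
    (τ : ((R × R) × P) ≃ₗ[R] ((R × R) × P)) ((a, b), p) = ((a + B p q, b), p - b • q)

/-- `ETrans_O(Q)`: generated by the `ρ(q)` and `μ(q)`. These are orthogonal transvections (or
even isometries) exactly when `q` is isotropic. -/
def eTransO (B : LinearMap.BilinForm R P) : Subgroup (isometryGroup (formQ B)) :=
  Subgroup.closure {τ | ∃ q : P, B q q = 0 ∧ (IsRho B q τ ∨ IsMu B q τ)}

/-- `ETrans_O(IQ)`: generated by the `ρ(q)` and `μ(q)` with `q ∈ IP` isotropic. -/
def eTransOIdeal (B : LinearMap.BilinForm R P) (I : Ideal R) :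
    Subgroup (isometryGroup (formQ B)) :=
  Subgroup.closure {τ | ∃ q ∈ I • (⊤ : Submodule R P), B q q = 0 ∧ (IsRho B q τ ∨ IsMu B q τ)}

/-- `ETrans_O(Q, IQ)`: the normal closure of `ETrans_O(IQ)` in `ETrans_O(Q)`. -/
def relETransO (B : LinearMap.BilinForm R P) (I : Ideal R) :
    Subgroup (isometryGroup (formQ B)) :=
  normalClosureIn (eTransOIdeal B I) (eTransO B)

end Hyperbolic

section Matrices

variable {R : Type*} [CommRing R]

/-- The permutation `σ` exchanging `2i - 1` and `2i`; with indices starting at `0`, it exchanges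
`2i` and `2i + 1`. -/
def sigma {m : ℕ} (i : Fin (2 * m)) : Fin (2 * m) :=
  ⟨if i.val % 2 = 0 then i.val + 1 else i.val - 1, by have := i.isLt; split_ifs <;> omega⟩

theorem sigma_ne {m : ℕ} (i : Fin (2 * m)) : sigma i ≠ i := by
  intro h
  have h' := congrArg Fin.val h
  simp only [sigma] at h'
  split_ifs at h' <;> omega

theorem sigma_sigma {m : ℕ} (i : Fin (2 * m)) : sigma (sigma i) = i := by
  apply Fin.ext
  simp only [sigma]
  split_ifs <;> omega

/-- The standard symmetric matrix `ψ̃_m`, of size `2m`. -/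
def psi (R : Type*) [CommRing R] (m : ℕ) : Matrix (Fin (2 * m)) (Fin (2 * m)) R :=
  Matrix.of fun i j => if j = sigma i then 1 else 0

/-- The orthogonal group `O_{2m}(R)` of `ψ̃_m`. -/
def orthGroup (R : Type*) [CommRing R] (m : ℕ) : Subgroup (GL (Fin (2 * m)) R) where
  carrier := {α | (α : Matrix (Fin (2 * m)) (Fin (2 * m)) R)ᵀ * psi R m *
    (α : Matrix (Fin (2 * m)) (Fin (2 * m)) R) = psi R m}
  mul_mem' := by
    intro a b ha hb
    simp only [Set.mem_ofPred_eq] at ha hb ⊢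
    rw [Units.val_mul, Matrix.transpose_mul]
    calc _ = (b.val)ᵀ * ((a.val)ᵀ * psi R m * a.val) * b.val := by simp only [Matrix.mul_assoc]
      _ = _ := by rw [ha, hb]
  one_mem' := by simp
  inv_mem' := by
    intro a ha
    simp only [Set.mem_ofPred_eq] at ha ⊢
    have h1 : a.val * (a⁻¹).val = 1 := a.mul_inv
    have h2 : ((a⁻¹).val)ᵀ * (a.val)ᵀ = 1 := by
      rw [← Matrix.transpose_mul, h1, Matrix.transpose_one]
    calc _ = ((a⁻¹).val)ᵀ * ((a.val)ᵀ * psi R m * a.val) * (a⁻¹).val := by rw [ha]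
      _ = (((a⁻¹).val)ᵀ * (a.val)ᵀ) * psi R m * (a.val * (a⁻¹).val) := by
        simp only [Matrix.mul_assoc]
      _ = _ := by rw [h1, h2, Matrix.one_mul, Matrix.mul_one]

/-- The matrix `1 + z e_{ij} - z e_{σ(j) σ(i)}`. -/
def oeMatrix {m : ℕ} (i j : Fin (2 * m)) (z : R) : Matrix (Fin (2 * m)) (Fin (2 * m)) R :=
  1 + Matrix.single i j z - Matrix.single (sigma j) (sigma i) z

/-- `EO_{2m}(I)`: the subgroup of `O_{2m}(R)` generated by the elementary orthogonal matrices
`oe_{ij}(z)`, `i ≠ j`, `i ≠ σ(j)`, with `z ∈ I`. For `I = R` this is `EO_{2m}(R)`. -/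
def eoIdeal (m : ℕ) (I : Ideal R) : Subgroup (orthGroup R m) :=
  Subgroup.closure {α | ∃ (i j : Fin (2 * m)) (z : R), i ≠ j ∧ i ≠ sigma j ∧ z ∈ I ∧
    ((α : GL (Fin (2 * m)) R) : Matrix (Fin (2 * m)) (Fin (2 * m)) R) = oeMatrix i j z}

/-- `EO_{2m}(R, I)`: the normal closure of `EO_{2m}(I)` in `EO_{2m}(R)`. -/
def relEO (m : ℕ) (I : Ideal R) : Subgroup (orthGroup R m) :=
  normalClosureIn (eoIdeal m I) (eoIdeal m (⊤ : Ideal R))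

/-- The bijection from the indices of `R² ⊕ R^{2n}` to those of `R^{2n+2}`, in the given order. -/
def blockIndex (n : ℕ) : Fin 2 ⊕ Fin (2 * n) ≃ Fin (2 * (n + 1)) :=
  finSumFinEquiv.trans (finCongr (by omega))

/-- The block sum `I₂ ⊥ ε`, of size `2n + 2`. -/
def onePerp {n : ℕ} (ε : GL (Fin (2 * n)) R) : GL (Fin (2 * (n + 1))) R where
  val := Matrix.reindex (blockIndex n) (blockIndex n) (Matrix.fromBlocks 1 0 0 ε.val)
  inv := Matrix.reindex (blockIndex n) (blockIndex n) (Matrix.fromBlocks 1 0 0 (ε⁻¹).val)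
  val_inv := by
    rw [Matrix.reindex_apply, Matrix.reindex_apply, Matrix.submatrix_mul_equiv,
      Matrix.fromBlocks_multiply]
    simp only [Matrix.mul_zero, Matrix.zero_mul, add_zero, zero_add, Units.mul_inv,
      Matrix.mul_one, Matrix.fromBlocks_one, Matrix.submatrix_one_equiv]
  inv_val := by
    rw [Matrix.reindex_apply, Matrix.reindex_apply, Matrix.submatrix_mul_equiv,
      Matrix.fromBlocks_multiply]
    simp only [Matrix.mul_zero, Matrix.zero_mul, add_zero, zero_add, Units.inv_mul,
      Matrix.mul_one, Matrix.fromBlocks_one, Matrix.submatrix_one_equiv]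

/-- The basis `(1, 0, 0), (0, 1, 0), (0, 0, b₁), …, (0, 0, b_{2n})` of `R² ⊕ P`. -/
noncomputable def basisQ {P : Type*} [AddCommGroup P] [Module R P] {n : ℕ}
    (b : Basis (Fin (2 * n)) R P) : Basis (Fin (2 * (n + 1))) R ((R × R) × P) :=
  ((Basis.finTwoProd R).prod b).reindex (blockIndex n)

/-- The matrix, with respect to a basis, of an automorphism (acting on coordinate columns). -/
noncomputable def matrixOf {M ι : Type*} [AddCommGroup M] [Module R M] [Fintype ι]
    [DecidableEq ι] (c : Basis ι R M) : (M ≃ₗ[R] M) ≃* GL ι R :=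
  (LinearMap.GeneralLinearGroup.generalLinearEquiv R M).symm.trans
    (Units.mapEquiv (LinearMap.toMatrixAlgEquiv c).toMulEquiv)

/-- The group of matrices, with respect to a basis, of a group of isometries. -/
noncomputable def matrixGroup {M ι : Type*} [AddCommGroup M] [Module R M] [Fintype ι]
    [DecidableEq ι] (c : Basis ι R M) {B : LinearMap.BilinForm R M}
    (H : Subgroup (isometryGroup B)) : Subgroup (GL ι R) :=
  (H.map (isometryGroup B).subtype).map (matrixOf c).toMonoidHom

end Matrices

end RelOrth

namespace RelOrth

/-! ### Relative normal closures. -/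

section NormalClosure

variable {G : Type*} [Group G]

/-! Both groups of isometries are compared with a third, `relElemGroup`, generated up to conjugation
by the Siegel transformations `E(f i, z • f j)` of a basis of orthogonal hyperbolic pairs. Such a
basis of `Q` exists because changing the basis of `P` by `ε` turns `φ` into `ψ̃_n`.

For isotropic `u`, the map `v ↦ E(u, v)` is additive on the orthogonal complement of `u` (this uses
1/2), it kills multiples of `u`, and `E(u, v) = E(v, -u)` when `v` is isotropic too. So the `v` with
`E(u, v)` in a given subgroup form an additive monoid (`siegelVectors`), and membership can be
checked on the summands of any decomposition of `v` orthogonal to `u`.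

If `u` is unimodular, its orthogonal complement is spanned by the Koszul vectors `⟨u, f i⟩ f j - ⟨u,
f j⟩ f i`, and a vector of level `I` is a combination of them with coefficients in `I`. If `j ≠ σ i`
the Koszul vector is isotropic; exchanging it with `u` and splitting `u` along the basis leaves
elementary factors and one commutator, formed with a third hyperbolic pair. The case `j = σ i`
follows from linear relations among Koszul vectors. This gives `relTransO_eq_relElemGroup`.

The maps `ρ(q)` and `μ(q)` are Siegel transformations along the two basis vectors of `ℍ(R)`. They
decompose into elementary ones by additivity; conversely, elementary ones inside `P` are commutators
through `ℍ(R)`. This gives `relETransO_eq_relElemGroup`. Finally `E(f i, z • f j)` has matrix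
`oe_{i,σ(j)}(z)`, and returning to the given basis conjugates by `I₂ ⊥ ε`. -/

theorem le_normalClosureIn {H K : Subgroup G} (h : H ≤ K) : H ≤ normalClosureIn H K := by
  intro x hx
  exact ⟨⟨x, h hx⟩, Subgroup.subset_normalClosure hx, rfl⟩

theorem normalClosureIn_le_right (H K : Subgroup G) : normalClosureIn H K ≤ K := by
  rintro _ ⟨x, -, rfl⟩
  exact x.2

theorem conj_mem_normalClosureIn {H K : Subgroup G} {k x : G} (hk : k ∈ K)
    (hx : x ∈ normalClosureIn H K) : k * x * k⁻¹ ∈ normalClosureIn H K := by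
  obtain ⟨y, hy, rfl⟩ := hx
  exact ⟨⟨k, hk⟩ * y * ⟨k, hk⟩⁻¹, Subgroup.normalClosure_normal.conj_mem _ hy _, rfl⟩

theorem normalClosureIn_le {H K N : Subgroup G} (h : H ≤ N)
    (hN : ∀ k ∈ K, ∀ x ∈ N, k * x * k⁻¹ ∈ N) : normalClosureIn H K ≤ N := by
  have : (N.subgroupOf K).Normal := ⟨fun x hx k => hN k k.2 x hx⟩
  rintro _ ⟨x, hx, rfl⟩
  have hle : Subgroup.normalClosure (H.subgroupOf K : Set K) ≤ N.subgroupOf K :=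
    Subgroup.normalClosure_le_normal fun y hy => h hy
  exact hle hx

theorem map_normalClosureIn {G' : Type*} [Group G'] (φ : G →* G') {H K : Subgroup G} (h : H ≤ K) :
    (normalClosureIn H K).map φ = normalClosureIn (H.map φ) (K.map φ) := by
  apply le_antisymm
  · rw [Subgroup.map_le_iff_le_comap]
    refine normalClosureIn_le ?_ ?_
    · exact Subgroup.map_le_iff_le_comap.1 (le_normalClosureIn (Subgroup.map_mono h))
    · intro k hk x hx
      rw [Subgroup.mem_comap, map_mul, map_mul, map_inv]
      exact conj_mem_normalClosureIn (Subgroup.mem_map_of_mem φ hk) hx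
  · refine normalClosureIn_le (Subgroup.map_mono (le_normalClosureIn h)) ?_
    rintro _ ⟨k, hk, rfl⟩ _ ⟨x, hx, rfl⟩
    exact ⟨k * x * k⁻¹, conj_mem_normalClosureIn hk hx, by simp⟩

end NormalClosure

/-! ### Siegel transformations and their identities. -/

section Siegel

variable {R : Type*} [CommRing R] {M : Type*} [AddCommGroup M] [Module R M]

theorem isometryGroup_ext {B : LinearMap.BilinForm R M} {τ τ' : isometryGroup B}
    (h : ∀ x, (τ : M ≃ₗ[R] M) x = (τ' : M ≃ₗ[R] M) x) : τ = τ' :=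
  Subtype.ext (LinearEquiv.ext h)

/-- The linear map `x ↦ x - ⟨u, x⟩ v + ⟨v, x⟩ u - c ⟨v, v⟩ ⟨u, x⟩ u`. -/
def siegelMap (B : LinearMap.BilinForm R M) (c : R) (u v : M) : M →ₗ[R] M :=
  LinearMap.id - (B u).smulRight v + (B v).smulRight u - (c * B v v) • (B u).smulRight u

theorem siegelMap_apply (B : LinearMap.BilinForm R M) (c : R) (u v x : M) :
    siegelMap B c u v x = x - B u x • v + B v x • u - (c * B v v * B u x) • u := by
  simp [siegelMap, mul_smul]

/-- The composition contributes `⟨v, w⟩` to the coefficient of `u`, and the quadratic term of `v +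
w` contributes `2c⟨v, w⟩`; they agree as `2c = 1`. -/
theorem siegelMap_siegelMap {B : LinearMap.BilinForm R M} (hB : ∀ x y, B x y = B y x) {c : R}
    (hc : 2 * c = 1) {u v w : M} (hu : B u u = 0) (hv : B u v = 0) (hw : B u w = 0) (x : M) :
    siegelMap B c u v (siegelMap B c u w x) = siegelMap B c u (v + w) x := by
  have hv' : B v u = 0 := by rw [hB, hv]
  simp only [siegelMap_apply, map_add, map_sub, map_smul, LinearMap.add_apply, hu, hw, hv',
    hB w v]
  match_scalars <;> first | ring1 | linear_combination (B u x * B v w) * hc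

/-- The Siegel transformation attached to an isotropic vector `u` and a vector `v` orthogonal
to it; here `c = 1/2`. -/
def siegel {B : LinearMap.BilinForm R M} (hB : ∀ x y, B x y = B y x) {c : R}
    (hc : 2 * c = 1) {u v : M} (hu : B u u = 0) (hv : B u v = 0) : isometryGroup B where
  val := LinearEquiv.ofLinearMap (siegelMap B c u v) (siegelMap B c u (-v))
    (by
      have h : B u (-v) = 0 := by rw [map_neg, hv, neg_zero]
      refine LinearMap.ext fun x => ?_
      rw [LinearMap.comp_apply, siegelMap_siegelMap hB hc hu hv h, siegelMap_apply]
      simp)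
    (by
      have h : B u (-v) = 0 := by rw [map_neg, hv, neg_zero]
      refine LinearMap.ext fun x => ?_
      rw [LinearMap.comp_apply, siegelMap_siegelMap hB hc hu h hv, siegelMap_apply]
      simp)
  property := by
    intro x y
    have hv' : B v u = 0 := by rw [hB, hv]
    simp only [LinearEquiv.coe_ofLinearMap, siegelMap_apply, map_add, map_sub, map_smul,
      LinearMap.add_apply, LinearMap.sub_apply, LinearMap.smul_apply, smul_eq_mul, hu, hv, hv',
      hB x u, hB x v]
    linear_combination (-(B u x * B u y * B v v)) * hc

variable {B : LinearMap.BilinForm R M} (hB : ∀ x y, B x y = B y x) {c : R} (hc : 2 * c = 1)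

theorem siegel_apply {u v : M} (hu : B u u = 0) (hv : B u v = 0) (x : M) :
    (siegel hB hc hu hv : M ≃ₗ[R] M) x =
      x - B u x • v + B v x • u - (c * B v v * B u x) • u :=
  siegelMap_apply B c u v x

theorem siegel_congr {u v u' v' : M} (hu : B u u = 0) (hv : B u v = 0) (hu' : u = u')
    (hv' : v = v') :
    siegel hB hc hu hv = siegel hB hc (u := u') (v := v') (by rw [← hu', hu])
      (by rw [← hu', ← hv', hv]) := by
  subst hu' hv'; rfl

theorem siegel_add {u v w : M} (hu : B u u = 0) (hv : B u v = 0) (hw : B u w = 0)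
    (hvw : B u (v + w) = 0) :
    siegel hB hc hu hvw = siegel hB hc hu hv * siegel hB hc hu hw :=
  isometryGroup_ext fun x => (siegelMap_siegelMap hB hc hu hv hw x).symm

theorem siegel_smul_self {u : M} (a : R) (hu : B u u = 0) (hau : B u (a • u) = 0) :
    siegel hB hc hu hau = 1 := by
  refine isometryGroup_ext fun x => ?_
  rw [siegel_apply]
  simp [hu, smul_smul, mul_comm]

theorem siegel_zero {u : M} (hu : B u u = 0) (h0 : B u 0 = 0) : siegel hB hc hu h0 = 1 := by
  refine isometryGroup_ext fun x => ?_
  rw [siegel_apply]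
  simp

theorem siegel_swap {u v : M} (hu : B u u = 0) (huv : B u v = 0) (hv : B v v = 0)
    (hvu : B v (-u) = 0) : siegel hB hc hu huv = siegel hB hc hv hvu := by
  refine isometryGroup_ext fun x => ?_
  rw [siegel_apply, siegel_apply]
  simp only [hu, hv, map_neg, LinearMap.neg_apply, neg_neg]
  module

theorem siegel_smul_left {u v : M} (a : R) (hu : B u u = 0) (hv : B v v = 0)
    (hau : B (a • u) (a • u) = 0) (huv : B (a • u) v = 0) (huv' : B u (a • v) = 0) :
    siegel hB hc hau huv = siegel hB hc hu huv' := by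
  refine isometryGroup_ext fun x => ?_
  rw [siegel_apply, siegel_apply]
  simp only [hv, map_smul, LinearMap.smul_apply, smul_eq_mul]
  module

theorem conj_siegel (g : isometryGroup B) {u v : M} (hu : B u u = 0) (hv : B u v = 0)
    (hu' : B ((g : M ≃ₗ[R] M) u) ((g : M ≃ₗ[R] M) u) = 0)
    (hv' : B ((g : M ≃ₗ[R] M) u) ((g : M ≃ₗ[R] M) v) = 0) :
    g * siegel hB hc hu hv * g⁻¹ = siegel hB hc hu' hv' := by
  rw [mul_inv_eq_iff_eq_mul]
  refine isometryGroup_ext fun x => ?_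
  change (g : M ≃ₗ[R] M) ((siegel hB hc hu hv : M ≃ₗ[R] M) x) =
    (siegel hB hc hu' hv' : M ≃ₗ[R] M) ((g : M ≃ₗ[R] M) x)
  rw [siegel_apply, siegel_apply, g.2, g.2, g.2]
  simp only [map_add, map_sub, map_smul]

/-- `E(x, e)` sends `e'` to `e' + x` and fixes `v`, so it conjugates `E(e', v)` into `E(e' + x, v)`.
Exchanging arguments makes additivity available in the first one, and this is `E(e', v) E(x, v)`. -/
theorem siegel_eq_commutator {x v e e' : M} (hx : B x x = 0) (hv : B v v = 0) (hxv : B x v = 0)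
    (he : B e e = 0) (he' : B e' e' = 0) (hee' : B e e' = 1) (hxe : B x e = 0) (hxe' : B x e' = 0)
    (hve : B v e = 0) (hve' : B e' v = 0) :
    siegel hB hc hx hxv = (siegel hB hc he' hve')⁻¹ *
      (siegel hB hc hx hxe * siegel hB hc he' hve' * (siegel hB hc hx hxe)⁻¹) := by
  rw [eq_inv_mul_iff_mul_eq, conj_siegel hB hc _ he' hve'
    (((siegel hB hc hx hxe).2 e' e').trans he') (((siegel hB hc hx hxe).2 e' v).trans hve')]
  have h1 : ((siegel hB hc hx hxe : isometryGroup B) : M ≃ₗ[R] M) e' = e' + x := by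
    rw [siegel_apply]; simp [hxe', hee', he]
  have h2 : ((siegel hB hc hx hxe : isometryGroup B) : M ≃ₗ[R] M) v = v := by
    rw [siegel_apply]; simp [hxv, hB e v, hve, he]
  rw [siegel_congr hB hc _ _ h1 h2]
  have hvx : B v x = 0 := by rw [hB, hxv]
  have hve2 : B v e' = 0 := by rw [hB, hve']
  rw [siegel_swap hB hc he' hve' hv (by simp [hve2]), siegel_swap hB hc hx hxv hv (by simp [hvx]),
    siegel_swap hB hc _ _ hv (by simp [hve2, hvx]), ← siegel_add hB hc hv _ _ (by simp [hve2, hvx])]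
  exact siegel_congr hB hc _ _ rfl (by abel)

/-- The vectors `v` orthogonal to `u` whose Siegel transformation lies in `H`. -/
def siegelVectors (H : Subgroup (isometryGroup B)) {u : M} (hu : B u u = 0) : AddSubmonoid M where
  carrier := {v | ∃ h : B u v = 0, siegel hB hc hu h ∈ H}
  zero_mem' := ⟨by simp, by rw [siegel_zero]; exact H.one_mem⟩
  add_mem' := by
    rintro v w ⟨hv, hv'⟩ ⟨hw, hw'⟩
    have h : B u (v + w) = 0 := by simp [hv, hw]
    exact ⟨h, by rw [siegel_add hB hc hu hv hw h]; exact H.mul_mem hv' hw'⟩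

theorem smul_self_mem_siegelVectors (H : Subgroup (isometryGroup B)) {u : M} (hu : B u u = 0)
    (a : R) : a • u ∈ siegelVectors hB hc H hu :=
  ⟨by simp [hu], by rw [siegel_smul_self]; exact H.one_mem⟩

theorem mem_siegelVectors_iff_neg {H : Subgroup (isometryGroup B)} {u v : M} {hu : B u u = 0}
    (hv : B v v = 0) : v ∈ siegelVectors hB hc H hu ↔ -u ∈ siegelVectors hB hc H hv := by
  have key : B u v = 0 ↔ B v (-u) = 0 := by rw [map_neg, neg_eq_zero, hB]
  constructor
  · rintro ⟨h, h'⟩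
    exact ⟨key.1 h, by rwa [← siegel_swap hB hc hu h hv]⟩
  · rintro ⟨h, h'⟩
    exact ⟨key.2 h, by rwa [siegel_swap hB hc hu (key.2 h) hv h]⟩

theorem mem_siegelVectors_of_smul {H : Subgroup (isometryGroup B)} {u v : M} {a : R}
    {hu : B u u = 0} (hau : B (a • u) (a • u) = 0) (hv : B v v = 0)
    (h : a • v ∈ siegelVectors hB hc H hu) : v ∈ siegelVectors hB hc H hau := by
  obtain ⟨h, h'⟩ := h
  have h1 : B (a • u) v = 0 := by
    rw [map_smul, LinearMap.smul_apply, ← map_smul]; exact h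
  exact ⟨h1, by rwa [siegel_smul_left hB hc a hu hv hau h1 h]⟩

theorem siegelVectors_mono {H K : Subgroup (isometryGroup B)} (hHK : H ≤ K) {u : M}
    (hu : B u u = 0) : siegelVectors hB hc H hu ≤ siegelVectors hB hc K hu :=
  fun _ ⟨h, h'⟩ => ⟨h, hHK h'⟩

/-- In the commutator only the factor `E(e', v)` has to be of level `H`; the other merely conjugates
and may lie in `K`. -/
theorem mem_siegelVectors_of_commutator {H K : Subgroup (isometryGroup B)} (hHK : H ≤ K)
    {x v e e' : M} (hx : B x x = 0) (hv : B v v = 0) (hxv : B x v = 0)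
    (he : B e e = 0) (he' : B e' e' = 0) (hee' : B e e' = 1) (hxe' : B x e' = 0)
    (hve : B v e = 0) (hx' : -x ∈ siegelVectors hB hc K he)
    (hv' : v ∈ siegelVectors hB hc H he') :
    v ∈ siegelVectors hB hc (normalClosureIn H K) hx := by
  obtain ⟨h1, h2⟩ := (mem_siegelVectors_iff_neg hB hc (hu := hx) he).2 hx'
  obtain ⟨h3, h4⟩ := hv'
  refine ⟨hxv, ?_⟩
  rw [siegel_eq_commutator hB hc hx hv hxv he he' hee' h1 hxe' hve h3]
  have h5 := le_normalClosureIn hHK h4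
  exact mul_mem (inv_mem h5) (conj_mem_normalClosureIn h2 h5)

end Siegel
end RelOrth

namespace RelOrth

/-! ### Transvections in a space with a hyperbolic basis. -/

section HyperbolicBasis

variable {R : Type*} [CommRing R] {M : Type*} [AddCommGroup M] [Module R M]

theorem apply_mem_of_mem_ideal_smul_top {I : Ideal R} {x : M} (φ : M →ₗ[R] R)
    (hx : x ∈ I • (⊤ : Submodule R M)) : φ x ∈ I := by
  induction hx using Submodule.smul_induction_on' with
  | smul r hr y hy => rw [map_smul]; exact I.mul_mem_right _ hr
  | add y hy z hz h1 h2 => rw [map_add]; exact I.add_mem h1 h2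

/-- The basis `f` consists of mutually orthogonal hyperbolic pairs `f i`, `f (σ i)`. -/
structure IsHyperbolicBasis {ι : Type*} [DecidableEq ι] (B : LinearMap.BilinForm R M)
    (f : Basis ι R M) (σ : ι → ι) : Prop where
  involutive : ∀ i, σ (σ i) = i
  ne : ∀ i, σ i ≠ i
  form : ∀ i j, B (f i) (f j) = if j = σ i then 1 else 0

variable {ι : Type*} {B : LinearMap.BilinForm R M}
  {f : Basis ι R M} {σ : ι → ι}

namespace IsHyperbolicBasis

variable [DecidableEq ι]

theorem form_self (hf : IsHyperbolicBasis B f σ) (i : ι) : B (f i) (f i) = 0 := by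
  rw [hf.form, if_neg (hf.ne i).symm]

theorem form_of_ne (hf : IsHyperbolicBasis B f σ) {i j : ι} (h : j ≠ σ i) :
    B (f i) (f j) = 0 := by
  rw [hf.form, if_neg h]

theorem form_sigma (hf : IsHyperbolicBasis B f σ) (i : ι) : B (f i) (f (σ i)) = 1 := by
  rw [hf.form, if_pos rfl]

theorem repr_eq [Fintype ι] (hf : IsHyperbolicBasis B f σ) (x : M) (i : ι) :
    f.repr x i = B (f (σ i)) x := by
  conv_rhs => rw [← f.sum_repr x]
  simp only [map_sum, map_smul, hf.form, hf.involutive, smul_eq_mul, mul_ite, mul_one, mul_zero,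
    Finset.sum_ite_eq', Finset.mem_univ, if_true]

end IsHyperbolicBasis

variable (hB : ∀ x y, B x y = B y x) {c : R} (hc : 2 * c = 1)

/-- The group generated by the Siegel transformations of the pairs `f i`, `z • f j` with
`z ∈ I`. -/
def elemGroup (f : Basis ι R M) (σ : ι → ι) (I : Ideal R) : Subgroup (isometryGroup B) :=
  Subgroup.closure {τ | ∃ (i j : ι) (z : R) (hu : B (f i) (f i) = 0)
    (hv : B (f i) (z • f j) = 0), i ≠ j ∧ i ≠ σ j ∧ z ∈ I ∧ τ = siegel hB hc hu hv}

/-- The relative group: the normal closure of the group of level `I` in the full group. -/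
def relElemGroup (f : Basis ι R M) (σ : ι → ι) (I : Ideal R) : Subgroup (isometryGroup B) :=
  normalClosureIn (elemGroup hB hc f σ I) (elemGroup hB hc f σ ⊤)

theorem elemGroup_mono {I J : Ideal R} (h : I ≤ J) :
    elemGroup hB hc f σ I ≤ elemGroup hB hc f σ J := by
  refine Subgroup.closure_mono ?_
  rintro τ ⟨i, j, z, hu, hv, hij, hij', hz, rfl⟩
  exact ⟨i, j, z, hu, hv, hij, hij', h hz, rfl⟩

theorem elemGroup_le_relElemGroup (I : Ideal R) :
    elemGroup hB hc f σ I ≤ relElemGroup hB hc f σ I :=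
  le_normalClosureIn (elemGroup_mono hB hc le_top)

theorem smul_mem_siegelVectors_elemGroup [DecidableEq ι] (hf : IsHyperbolicBasis B f σ) {I : Ideal R} {z : R}
    (hz : z ∈ I) {i j : ι} (hij : j ≠ σ i) :
    z • f j ∈ siegelVectors hB hc (elemGroup hB hc f σ I) (hf.form_self i) := by
  by_cases h : i = j
  · subst h
    exact smul_self_mem_siegelVectors hB hc _ _ z
  · have hv : B (f i) (z • f j) = 0 := by rw [map_smul, hf.form_of_ne hij, smul_zero]
    refine ⟨hv, Subgroup.subset_closure ⟨i, j, z, hf.form_self i, hv, h, ?_, hz, rfl⟩⟩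
    rintro rfl
    exact hij (hf.involutive j).symm

/-- The vector `⟨u, f i⟩ f j - ⟨u, f j⟩ f i`, which is orthogonal to `u`. -/
noncomputable def koszul (B : LinearMap.BilinForm R M) (f : Basis ι R M) (u : M) (i j : ι) : M :=
  B u (f i) • f j - B u (f j) • f i

theorem koszul_swap (u : M) (i j : ι) : koszul B f u j i = -koszul B f u i j := by
  rw [koszul, koszul, neg_sub]

variable [Fintype ι] [DecidableEq ι]

/-- Since `f i` and `f j` span a totally isotropic submodule, `v = a • koszul B f u i j` is
isotropic and can be exchanged with `u`. It then suffices to split `-u` into pieces orthogonal to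
`v`. -/
theorem smul_koszul_mem_of_ne (hf : IsHyperbolicBasis B f σ)
    (hcard : ∀ i j, ∃ k, k ≠ i ∧ k ≠ j ∧ k ≠ σ i ∧ k ≠ σ j) {I : Ideal R} {u : M}
    (hu : B u u = 0) {a : R} (ha : a ∈ I) {i j : ι} (hij : j ≠ i) (hij' : j ≠ σ i) :
    a • koszul B f u i j ∈ siegelVectors hB hc (relElemGroup hB hc f σ I) hu := by
  have hji' : i ≠ σ j := by
    rintro rfl
    exact hij' (hf.involutive j).symm
  have hσ : σ i ≠ σ j := fun h => hij (by rw [← hf.involutive j, ← h, hf.involutive])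
  set s := B u (f i) with hs
  set t := B u (f j) with ht
  have hsr : f.repr u (σ i) = s := by rw [hf.repr_eq, hf.involutive, hB]
  have htr : f.repr u (σ j) = t := by rw [hf.repr_eq, hf.involutive, hB]
  set v := a • koszul B f u i j with hv
  have hv' : v = (a * s) • f j + (-(a * t)) • f i := by
    rw [hv, koszul]
    module
  clear_value v
  have hvk : ∀ k, k ≠ σ i → k ≠ σ j → B v (f k) = 0 := by
    intro k hi hj
    rw [hv']
    simp [hf.form_of_ne hi, hf.form_of_ne hj]
  have hvv : B v v = 0 := by
    suffices h : B v ((a * s) • f j + (-(a * t)) • f i) = 0 by rwa [← hv'] at h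
    rw [map_add, map_smul, map_smul, hvk j hij' (hf.ne j).symm, hvk i (hf.ne i).symm hji']
    simp
  have helem : ∀ (d : R) (k : ι), k ≠ σ i → k ≠ σ j →
      d • v ∈ siegelVectors hB hc (elemGroup hB hc f σ I) (hf.form_self k) := by
    intro d k hi hj
    rw [hv', smul_add, smul_smul, smul_smul]
    refine add_mem
      (smul_mem_siegelVectors_elemGroup hB hc hf (I.mul_mem_left _ (I.mul_mem_right _ ha)) ?_)
      (smul_mem_siegelVectors_elemGroup hB hc hf
        (I.mul_mem_left _ (I.neg_mem (I.mul_mem_right _ ha))) ?_)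
    · rintro rfl
      exact hj (hf.involutive k).symm
    · rintro rfl
      exact hi (hf.involutive k).symm
  rw [mem_siegelVectors_iff_neg hB hc hvv]
  -- Only `f (σ i)` and `f (σ j)` can pair nontrivially with `v`. Their terms in `u` must stay
  -- together: only the combination is orthogonal to `v`.
  have hsum : -u = -(s • f (σ i) + t • f (σ j)) +
      ∑ k ∈ (Finset.univ.erase (σ i)).erase (σ j), -(f.repr u k • f k) := by
    rw [Finset.sum_neg_distrib, ← neg_add, neg_inj]
    conv_lhs => rw [← f.sum_repr u]
    rw [← Finset.add_sum_erase _ _ (Finset.mem_univ (σ i)),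
      ← Finset.add_sum_erase _ _ (Finset.mem_erase.2 ⟨hσ.symm, Finset.mem_univ (σ j)⟩), hsr, htr,
      add_assoc]
  rw [hsum]
  refine add_mem ?_ (sum_mem fun k hk => ?_)
  · set x := s • f (σ i) + t • f (σ j) with hx
    have hxx : B x x = 0 := by
      simp [hx, hf.form, hf.involutive, hf.ne, hij'.symm, hji'.symm]
    rw [← mem_siegelVectors_iff_neg hB hc (hu := hxx)]
    -- The pair `f k`, `f (σ k)` is orthogonal to both `x` and `v` and carries the commutator.
    obtain ⟨k, hki, hkj, hki', hkj'⟩ := hcard i j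
    have hxk : ∀ k, k ≠ i → k ≠ j → B x (f k) = 0 := by
      intro k hi hj
      simp [hx, hf.form, hf.involutive, hi, hj]
    have hvx : B v x = 0 := by
      rw [hv']
      simp [hx, hf.form, hσ, hσ.symm]
      ring
    have hσki : σ k ≠ i := fun h => hki' (by rw [← h, hf.involutive])
    have hσkj : σ k ≠ j := fun h => hkj' (by rw [← h, hf.involutive])
    have hσki' : σ k ≠ σ i := fun h => hki (by rw [← hf.involutive k, h, hf.involutive])
    have hσkj' : σ k ≠ σ j := fun h => hkj (by rw [← hf.involutive k, h, hf.involutive])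
    refine mem_siegelVectors_of_commutator hB hc (elemGroup_mono hB hc le_top) hxx hvv
      (by rw [hB, hvx]) (hf.form_self k) (hf.form_self (σ k)) (hf.form_sigma k)
      (hxk _ hσki hσkj) (hvk k hki' hkj') ?_ ?_
    · rw [hx, neg_add, ← neg_smul, ← neg_smul]
      exact add_mem (smul_mem_siegelVectors_elemGroup hB hc hf Submodule.mem_top hσki'.symm)
        (smul_mem_siegelVectors_elemGroup hB hc hf Submodule.mem_top hσkj'.symm)
    · simpa using helem 1 (σ k) hσki' hσkj'
  · have hkj := Finset.ne_of_mem_erase hk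
    have hki := Finset.ne_of_mem_erase (Finset.mem_of_mem_erase hk)
    -- With `d` the `k`-th coordinate of `u`, `E(v, -d • f k) = E(d • f k, v) = E(f k, d • v)`, a
    -- product of elementary transformations of level `I`.
    rw [← mem_siegelVectors_iff_neg hB hc (hu := by simp [hf.form_self])]
    exact mem_siegelVectors_of_smul hB hc _ hvv (siegelVectors_mono hB hc
      (elemGroup_le_relElemGroup hB hc I) _ (helem _ k hki hkj))

/-- The Koszul vectors `(i, k)`, weighted by the coordinates of `u`, sum to `⟨u, f i⟩ u - ⟨u, u⟩ f i
= ⟨u, f i⟩ u`, which acts trivially. The term `k = σ i` has weight `⟨u, f i⟩`, so it is expressed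
through Koszul vectors already treated. -/
theorem smul_koszul_sigma_mem (hf : IsHyperbolicBasis B f σ)
    (hcard : ∀ i j, ∃ k, k ≠ i ∧ k ≠ j ∧ k ≠ σ i ∧ k ≠ σ j) {I : Ideal R} {u : M}
    (hu : B u u = 0) {a : R} (ha : a ∈ I) (i : ι) :
    (a * B u (f i)) • koszul B f u i (σ i) ∈
      siegelVectors hB hc (relElemGroup hB hc f σ I) hu := by
  have hr : f.repr u (σ i) = B u (f i) := by rw [hf.repr_eq, hf.involutive, hB]
  have hsum : ∑ k, f.repr u k • koszul B f u i k = B u (f i) • u := by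
    simp only [koszul, smul_sub, Finset.sum_sub_distrib]
    have h1 : ∑ k, f.repr u k • B u (f i) • f k = B u (f i) • u := by
      conv_rhs => enter [2]; rw [← f.sum_repr u]
      rw [Finset.smul_sum]
      exact Finset.sum_congr rfl fun k _ => by rw [smul_comm]
    have h2 : ∑ k, f.repr u k • B u (f k) • f i = B u u • f i := by
      conv_rhs => enter [1, 2]; rw [← f.sum_repr u]
      rw [map_sum, Finset.sum_smul]
      exact Finset.sum_congr rfl fun k _ => by rw [map_smul, smul_smul, smul_eq_mul]
    rw [h1, h2, hu, zero_smul, sub_zero]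
  have hself : koszul B f u i i = 0 := by rw [koszul, sub_self]
  rw [← Finset.add_sum_erase _ _ (Finset.mem_univ (σ i)), hr] at hsum
  have hmain : (a * B u (f i)) • koszul B f u i (σ i) =
      (a * B u (f i)) • u + ∑ k ∈ Finset.univ.erase (σ i),
        (-(f.repr u k * a)) • koszul B f u i k := by
    rw [mul_smul, mul_smul, ← hsum, smul_add, add_assoc, left_eq_add, Finset.smul_sum,
      ← Finset.sum_add_distrib]
    exact Finset.sum_eq_zero fun k _ => by module
  rw [hmain]
  refine add_mem (smul_self_mem_siegelVectors hB hc _ hu _) (sum_mem fun k hk => ?_)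
  by_cases hki : k = i
  · subst hki
    rw [hself, smul_zero]
    exact zero_mem _
  · exact smul_koszul_mem_of_ne hB hc hf hcard hu (I.neg_mem (I.mul_mem_left _ ha)) hki
      (Finset.ne_of_mem_erase hk)

/-- For `j = σ i`, unimodularity writes `a` as a combination of the `⟨u, f k⟩`, so one such factor
may be assumed present. -/
theorem smul_koszul_mem (hf : IsHyperbolicBasis B f σ)
    (hcard : ∀ i j, ∃ k, k ≠ i ∧ k ≠ j ∧ k ≠ σ i ∧ k ≠ σ j) {I : Ideal R} {u w : M}
    (hu : B u u = 0) (huw : B u w = 1) {a : R} (ha : a ∈ I) (i j : ι) :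
    a • koszul B f u i j ∈ siegelVectors hB hc (relElemGroup hB hc f σ I) hu := by
  by_cases hij : j = i
  · subst hij
    rw [koszul, sub_self, smul_zero]
    exact zero_mem _
  by_cases hij' : j = σ i
  swap
  · exact smul_koszul_mem_of_ne hB hc hf hcard hu ha hij hij'
  subst hij'
  have hw : ∑ k, f.repr w k * B u (f k) = 1 := by
    rw [← huw]
    conv_rhs => rw [← f.sum_repr w]
    simp only [map_sum, map_smul, smul_eq_mul]
  have hsum : a • koszul B f u i (σ i) =
      ∑ k, (a * f.repr w k * B u (f k)) • koszul B f u i (σ i) := by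
    rw [← Finset.sum_smul]
    simp only [mul_assoc]
    rw [← Finset.mul_sum, hw, mul_one]
  rw [hsum]
  refine sum_mem fun k _ => ?_
  have ha' : a * f.repr w k ∈ I := I.mul_mem_right _ ha
  by_cases hki : k = i
  · subst hki
    exact smul_koszul_sigma_mem hB hc hf hcard hu ha' k
  by_cases hki' : k = σ i
  · subst hki'
    have h := smul_koszul_sigma_mem hB hc hf hcard hu (I.neg_mem ha') (σ i)
    rwa [hf.involutive, koszul_swap, smul_neg, ← neg_smul, neg_mul, neg_neg] at h
  -- A three-term Plücker-type relation trades the pair `(i, σ i)` for `(k, σ i)` and `(k, i)`,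
  -- neither of which is hyperbolic.
  · have h : (a * f.repr w k * B u (f k)) • koszul B f u i (σ i) =
        (a * f.repr w k * B u (f i)) • koszul B f u k (σ i) +
          (-(a * f.repr w k * B u (f (σ i)))) • koszul B f u k i := by
      simp only [koszul]
      module
    rw [h]
    refine add_mem
      (smul_koszul_mem_of_ne hB hc hf hcard hu (I.mul_mem_right _ ha') (Ne.symm hki') ?_)
      (smul_koszul_mem_of_ne hB hc hf hcard hu (I.neg_mem (I.mul_mem_right _ ha')) (Ne.symm hki) ?_)
    · intro h
      exact hki (by rw [← hf.involutive k, ← h, hf.involutive])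
    · rintro rfl
      exact hki' (hf.involutive k).symm

/-- Siegel transformations of level `I` along unimodular isotropic vectors lie in the relative
elementary group. -/
theorem siegel_mem_relElemGroup (hf : IsHyperbolicBasis B f σ)
    (hcard : ∀ i j, ∃ k, k ≠ i ∧ k ≠ j ∧ k ≠ σ i ∧ k ≠ σ j) {I : Ideal R} {u v w : M}
    (hu : B u u = 0) (huw : B u w = 1) (huv : B u v = 0)
    (hv : v ∈ I • (⊤ : Submodule R M)) :
    siegel hB hc hu huv ∈ relElemGroup hB hc f σ I := by
  suffices h : v ∈ siegelVectors hB hc (relElemGroup hB hc f σ I) hu from h.2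
  -- Exactness of the Koszul complex of a unimodular vector: the double sum is `⟨u, w⟩ v - ⟨u, v⟩
  -- w`.
  have hsum : v = ∑ k, ∑ l, (f.repr v k * f.repr w l) • koszul B f u l k := by
    have h1 : ∀ k, ∑ l, (f.repr v k * f.repr w l) • koszul B f u l k =
        f.repr v k • f k - (f.repr v k * B u (f k)) • w := by
      intro k
      have hw : ∑ l, f.repr w l * B u (f l) = 1 := by
        rw [← huw]
        conv_rhs => rw [← f.sum_repr w]
        simp only [map_sum, map_smul, smul_eq_mul]
      calc _ = ∑ l, ((f.repr w l * B u (f l)) • f.repr v k • f k -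
            (f.repr v k * B u (f k)) • f.repr w l • f l) :=
            Finset.sum_congr rfl fun l _ => by rw [koszul]; module
        _ = _ := by
          rw [Finset.sum_sub_distrib, ← Finset.sum_smul, hw, one_smul, ← Finset.smul_sum,
            f.sum_repr]
    have hv0 : ∑ k, f.repr v k * B u (f k) = 0 := by
      rw [← huv]
      conv_rhs => rw [← f.sum_repr v]
      simp only [map_sum, map_smul, smul_eq_mul]
    rw [Finset.sum_congr rfl fun k _ => h1 k, Finset.sum_sub_distrib, ← Finset.sum_smul, hv0,
      zero_smul, sub_zero, f.sum_repr]
  rw [hsum]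
  refine sum_mem fun k _ => sum_mem fun l _ => smul_koszul_mem hB hc hf hcard hu huw ?_ l k
  exact I.mul_mem_right _ (apply_mem_of_mem_ideal_smul_top (f.coord k) hv)

theorem IsHyperbolicBasis.exists_apply_eq_one (hf : IsHyperbolicBasis B f σ)
    (hB : ∀ x y, B x y = B y x) {u : M} (hu : IsUnimodular R u) : ∃ w, B u w = 1 := by
  obtain ⟨φ, hφ⟩ := hu
  -- The vector representing `φ` through the form.
  refine ⟨∑ k, φ (f k) • f (σ k), ?_⟩
  rw [← hφ]
  conv_rhs => rw [← f.sum_repr u]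
  simp only [map_sum, map_smul, smul_eq_mul, hf.repr_eq]
  exact Finset.sum_congr rfl fun k _ => by rw [hB u, mul_comm]

theorem IsTransvectionPair.swap {u v : M} (hB : ∀ x y, B x y = B y x)
    (h : IsTransvectionPair B u v) : IsTransvectionPair B v u :=
  ⟨h.isotropic_right, h.isotropic_left, by rw [hB, h.orthogonal], h.unimodular.symm⟩

theorem siegel_mem_of_isTransvectionPair (hf : IsHyperbolicBasis B f σ)
    (hcard : ∀ i j, ∃ k, k ≠ i ∧ k ≠ j ∧ k ≠ σ i ∧ k ≠ σ j) {I : Ideal R} {u v : M}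
    (h : IsTransvectionPair B u v) (hu : IsUnimodular R u)
    (hI : u ∈ I • (⊤ : Submodule R M) ∨ v ∈ I • (⊤ : Submodule R M)) :
    siegel hB hc h.isotropic_left h.orthogonal ∈ relElemGroup hB hc f σ I := by
  obtain ⟨w, hw⟩ := hf.exists_apply_eq_one hB hu
  refine siegel_mem_relElemGroup hB hc hf hcard h.isotropic_left hw h.orthogonal ?_
  rcases hI with hI | hI
  -- A unimodular vector in `IM` forces `I = R`.
  · obtain ⟨φ, hφ⟩ := hu
    have h1 : (1 : R) ∈ I := hφ ▸ apply_mem_of_mem_ideal_smul_top φ hI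
    rw [(Ideal.eq_top_iff_one I).2 h1, Submodule.top_smul]
    exact Submodule.mem_top
  · exact hI

/-- Isometries carry transvection pairs of level `I` to such pairs. Hence a normal closure lies in
`relTransO` as soon as its generators do. -/
theorem conj_mem_relTransO {I : Ideal R} (g : isometryGroup B)
    {τ : isometryGroup B} (hτ : τ ∈ relTransO B I) : g * τ * g⁻¹ ∈ relTransO B I := by
  have hsmul : ∀ x : M, x ∈ I • (⊤ : Submodule R M) →
      (g : M ≃ₗ[R] M) x ∈ I • (⊤ : Submodule R M) := by
    intro x hx
    have h := Submodule.mem_map_of_mem (f := (g : M ≃ₗ[R] M).toLinearMap) hx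
    rw [Submodule.map_smul''] at h
    exact Submodule.smul_mono le_rfl le_top h
  have huni : ∀ x : M, IsUnimodular R x → IsUnimodular R ((g : M ≃ₗ[R] M) x) := by
    rintro x ⟨φ, hφ⟩
    exact ⟨φ ∘ₗ (g : M ≃ₗ[R] M).symm.toLinearMap, by simp [hφ]⟩
  unfold relTransO at hτ
  induction hτ using Subgroup.closure_induction with
  | mem τ h =>
    obtain ⟨u, v, h, hI, hτ⟩ := h
    refine Subgroup.subset_closure ⟨(g : M ≃ₗ[R] M) u, (g : M ≃ₗ[R] M) v,
      ⟨by rw [g.2, h.isotropic_left], by rw [g.2, h.isotropic_right], by rw [g.2, h.orthogonal],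
        h.unimodular.imp (huni u) (huni v)⟩, hI.imp (hsmul u) (hsmul v), fun p => ?_⟩
    obtain ⟨x, rfl⟩ := (g : M ≃ₗ[R] M).surjective p
    have hx : ((g * τ * g⁻¹ : isometryGroup B) : M ≃ₗ[R] M) ((g : M ≃ₗ[R] M) x) =
        (g : M ≃ₗ[R] M) ((τ : M ≃ₗ[R] M) x) :=
      congrArg (fun y => (g : M ≃ₗ[R] M) ((τ : M ≃ₗ[R] M) y))
        ((g : M ≃ₗ[R] M).symm_apply_apply x)
    rw [hx, hτ, g.2, g.2]
    simp only [map_add, map_sub, map_smul]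
  | one => rw [mul_one, mul_inv_cancel]; exact one_mem _
  | mul x y _ _ hx hy =>
    have h : g * (x * y) * g⁻¹ = (g * x * g⁻¹) * (g * y * g⁻¹) := by group
    rw [h]
    exact mul_mem hx hy
  | inv x _ hx =>
    have h : g * x⁻¹ * g⁻¹ = (g * x * g⁻¹)⁻¹ := by group
    rw [h]
    exact inv_mem hx

/-- The group of orthogonal transvections of level `I` is the relative elementary group. -/
theorem relTransO_eq_relElemGroup (hf : IsHyperbolicBasis B f σ)
    (hcard : ∀ i j, ∃ k, k ≠ i ∧ k ≠ j ∧ k ≠ σ i ∧ k ≠ σ j) (I : Ideal R) :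
    relTransO B I = relElemGroup hB hc f σ I := by
  apply le_antisymm
  · unfold relTransO
    rw [Subgroup.closure_le]
    rintro τ ⟨u, v, h, hI, hτ⟩
    have hτ' : τ = siegel hB hc h.isotropic_left h.orthogonal := by
      refine isometryGroup_ext fun x => ?_
      rw [hτ, siegel_apply, h.isotropic_right]
      simp
    rw [SetLike.mem_coe, hτ']
    rcases h.unimodular with hu | hv
    · exact siegel_mem_of_isTransvectionPair hB hc hf hcard h hu hI
    · have h' : IsTransvectionPair B v (-u) := by
        have hs := h.swap hB
        exact ⟨hs.isotropic_left, by simp [hs.isotropic_right], by simp [hs.orthogonal], Or.inl hv⟩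
      rw [siegel_swap hB hc h.isotropic_left h.orthogonal h.isotropic_right h'.orthogonal]
      refine siegel_mem_of_isTransvectionPair hB hc hf hcard h' hv (hI.symm.imp_right ?_)
      exact fun hu => neg_mem hu
  · refine normalClosureIn_le ?_ fun k _ x hx => conj_mem_relTransO k hx
    unfold elemGroup
    rw [Subgroup.closure_le]
    rintro τ ⟨i, j, z, hu, hv, hij, hij', hz, rfl⟩
    refine Subgroup.subset_closure ⟨f i, z • f j, ⟨hu, by simp [hf.form_self], hv,
      Or.inl ⟨f.coord i, by simp⟩⟩, Or.inr (Submodule.smul_mem_smul hz Submodule.mem_top),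
      fun x => ?_⟩
    rw [siegel_apply]
    simp [hf.form_self]

end HyperbolicBasis
end RelOrth

namespace RelOrth

/-! ### Elementary transvections of `ℍ(R) ⊕ P`. -/

section ElementaryTransvections

variable {R : Type*} [CommRing R] {P : Type*} [AddCommGroup P] [Module R P]

theorem formQ_apply (B : LinearMap.BilinForm R P) (x y : (R × R) × P) :
    formQ B x y = y.1.2 * x.1.1 + x.1.2 * y.1.1 + B x.2 y.2 := rfl

theorem formQ_symm {B : LinearMap.BilinForm R P} (hB : ∀ x y, B x y = B y x)
    (x y : (R × R) × P) : formQ B x y = formQ B y x := by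
  rw [formQ_apply, formQ_apply, hB]
  ring

theorem sigma_blockIndex_zero (n : ℕ) :
    sigma (blockIndex n (Sum.inl 0)) = blockIndex n (Sum.inl 1) := rfl

theorem sigma_blockIndex_one (n : ℕ) :
    sigma (blockIndex n (Sum.inl 1)) = blockIndex n (Sum.inl 0) := rfl

theorem sigma_blockIndex_inr (n : ℕ) (k : Fin (2 * n)) :
    sigma (blockIndex n (Sum.inr k)) = blockIndex n (Sum.inr (sigma k)) := by
  apply Fin.ext
  simp only [sigma, blockIndex, Equiv.trans_apply, finSumFinEquiv_apply_right, finCongr_apply,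
    Fin.val_cast, Fin.val_natAdd]
  split_ifs <;> omega

/-- Four indices cannot exhaust `2m ≥ 6`; for `Q`, with `m = n + 1`, this is where `n ≥ 2` enters.
-/
theorem exists_ne_sigma {m : ℕ} (hm : 3 ≤ m) (i j : Fin (2 * m)) :
    ∃ k, k ≠ i ∧ k ≠ j ∧ k ≠ sigma i ∧ k ≠ sigma j := by
  have hlt : ({i, j, sigma i, sigma j} : Finset (Fin (2 * m))).card < Fintype.card (Fin (2 * m)) :=
    Finset.card_le_four.trans_lt (by rw [Fintype.card_fin]; omega)
  obtain ⟨k, hk⟩ := Finset.exists_mem_notMem_of_card_lt_card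
    (s := {i, j, sigma i, sigma j}) (t := Finset.univ) hlt
  exact ⟨k, by simpa using hk⟩

variable {n : ℕ}

theorem basisQ_zero (p : Basis (Fin (2 * n)) R P) :
    basisQ p (blockIndex n (Sum.inl 0)) = ((1, 0), 0) := by
  simp [basisQ]

theorem basisQ_one (p : Basis (Fin (2 * n)) R P) :
    basisQ p (blockIndex n (Sum.inl 1)) = ((0, 1), 0) := by
  simp [basisQ]

theorem basisQ_inr (p : Basis (Fin (2 * n)) R P) (k : Fin (2 * n)) :
    basisQ p (blockIndex n (Sum.inr k)) = (0, p k) := by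
  simp [basisQ]

variable {B : LinearMap.BilinForm R P} {p : Basis (Fin (2 * n)) R P}

theorem isHyperbolicBasis_basisQ (hp : IsHyperbolicBasis B p sigma) :
    IsHyperbolicBasis (formQ B) (basisQ p) sigma where
  involutive := sigma_sigma
  ne := sigma_ne
  form := by
    intro i j
    obtain ⟨i, rfl⟩ := (blockIndex n).surjective i
    obtain ⟨j, rfl⟩ := (blockIndex n).surjective j
    rcases i with i | i <;> rcases j with j | j <;> (try fin_cases i) <;> (try fin_cases j) <;>
      simp [formQ_apply, basisQ_zero, basisQ_one, basisQ_inr, sigma_blockIndex_zero,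
        sigma_blockIndex_one, sigma_blockIndex_inr, hp.form]

variable (hB : ∀ x y, B x y = B y x) {c : R} (hc : 2 * c = 1)

theorem isRho_iff {q : P} (hq : B q q = 0) {τ : isometryGroup (formQ B)}
    (hu : formQ B (basisQ p (blockIndex n (Sum.inl 1))) (basisQ p (blockIndex n (Sum.inl 1))) = 0)
    (hv : formQ B (basisQ p (blockIndex n (Sum.inl 1))) (0, q) = 0) :
    IsRho B q τ ↔ τ = siegel (formQ_symm hB) hc hu hv := by
  have key : ∀ x : (R × R) × P,
      (siegel (formQ_symm hB) hc hu hv : ((R × R) × P) ≃ₗ[R] ((R × R) × P)) x =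
        ((x.1.1, x.1.2 + B x.2 q), x.2 - x.1.1 • q) := by
    intro x
    rw [siegel_apply, basisQ_one]
    simp only [formQ_apply]
    ext <;> simp [hq, hB q]
  constructor
  · intro h
    exact isometryGroup_ext fun x => (h x.1.1 x.1.2 x.2).trans (key x).symm
  · rintro rfl a b p
    exact key _

theorem isMu_iff {q : P} (hq : B q q = 0) {τ : isometryGroup (formQ B)}
    (hu : formQ B (basisQ p (blockIndex n (Sum.inl 0))) (basisQ p (blockIndex n (Sum.inl 0))) = 0)
    (hv : formQ B (basisQ p (blockIndex n (Sum.inl 0))) (0, q) = 0) :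
    IsMu B q τ ↔ τ = siegel (formQ_symm hB) hc hu hv := by
  have key : ∀ x : (R × R) × P,
      (siegel (formQ_symm hB) hc hu hv : ((R × R) × P) ≃ₗ[R] ((R × R) × P)) x =
        ((x.1.1 + B x.2 q, x.1.2), x.2 - x.1.2 • q) := by
    intro x
    rw [siegel_apply, basisQ_zero]
    simp only [formQ_apply]
    ext <;> simp [hq, hB q]
  constructor
  · intro h
    exact isometryGroup_ext fun x => (h x.1.1 x.1.2 x.2).trans (key x).symm
  · rintro rfl a b p
    exact key _

theorem formQ_basisQ_inl (hp : IsHyperbolicBasis B p sigma) (s : Fin 2) :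
    formQ B (basisQ p (blockIndex n (Sum.inl s))) (basisQ p (blockIndex n (Sum.inl s))) = 0 :=
  (isHyperbolicBasis_basisQ hp).form_self _

theorem formQ_basisQ_inl_inr (p : Basis (Fin (2 * n)) R P) (s : Fin 2) (q : P) :
    formQ B (basisQ p (blockIndex n (Sum.inl s))) (0, q) = 0 := by
  fin_cases s <;> simp [basisQ_zero, basisQ_one, formQ_apply]

theorem eTransOIdeal_le_eTransO (B : LinearMap.BilinForm R P) (I : Ideal R) :
    eTransOIdeal B I ≤ eTransO B :=
  Subgroup.closure_mono fun _ ⟨q, _, h⟩ => ⟨q, h⟩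

theorem eTransOIdeal_top (B : LinearMap.BilinForm R P) : eTransOIdeal B ⊤ = eTransO B := by
  refine le_antisymm (eTransOIdeal_le_eTransO B ⊤) (Subgroup.closure_mono ?_)
  rintro _ ⟨q, h⟩
  exact ⟨q, by rw [Submodule.top_smul]; exact Submodule.mem_top, h⟩

theorem mem_siegelVectors_eTransOIdeal (hp : IsHyperbolicBasis B p sigma)
    (I : Ideal R) (s : Fin 2) {q : P} (hq : B q q = 0)
    (hqI : q ∈ I • (⊤ : Submodule R P)) :
    ((0, q) : (R × R) × P) ∈ siegelVectors (formQ_symm hB) hc (eTransOIdeal B I)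
      (formQ_basisQ_inl hp s) := by
  refine ⟨formQ_basisQ_inl_inr p s q, Subgroup.subset_closure ⟨q, hqI, hq, ?_⟩⟩
  fin_cases s
  · exact Or.inr ((isMu_iff hB hc hq _ _).2 rfl)
  · exact Or.inl ((isRho_iff hB hc hq _ _).2 rfl)

theorem smul_basisQ_mem_siegelVectors (hp : IsHyperbolicBasis B p sigma)
    (I : Ideal R) (s : Fin 2) (k : Fin (2 * n)) {z : R}
    (hz : z ∈ I) : z • basisQ p (blockIndex n (Sum.inr k)) ∈
      siegelVectors (formQ_symm hB) hc (eTransOIdeal B I) (formQ_basisQ_inl hp s) := by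
  have h : z • basisQ p (blockIndex n (Sum.inr k)) = (0, z • p k) := by
    rw [basisQ_inr, Prod.smul_mk, smul_zero]
  rw [h]
  exact mem_siegelVectors_eTransOIdeal hB hc hp I s (by simp [hp.form_self])
    (Submodule.smul_mem_smul hz Submodule.mem_top)

/-- Additivity in `q` reduces to multiples of the basis vectors of `P`, with coefficients in `I`. -/
theorem eTransOIdeal_le_elemGroup (hp : IsHyperbolicBasis B p sigma)
    (I : Ideal R) :
    eTransOIdeal B I ≤ elemGroup (formQ_symm hB) hc (basisQ p) sigma I := by
  have key : ∀ (s : Fin 2) (q : P), q ∈ I • (⊤ : Submodule R P) → ((0, q) : (R × R) × P) ∈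
      siegelVectors (formQ_symm hB) hc (elemGroup (formQ_symm hB) hc (basisQ p) sigma I)
        (formQ_basisQ_inl hp s) := by
    intro s q hq
    have hsum : ((0, q) : (R × R) × P) =
        ∑ k, p.repr q k • basisQ p (blockIndex n (Sum.inr k)) := by
      simp only [basisQ_inr]
      rw [Prod.ext_iff]
      simp [Prod.fst_sum, Prod.snd_sum, p.sum_repr]
    rw [hsum]
    refine sum_mem fun k _ => smul_mem_siegelVectors_elemGroup (formQ_symm hB) hc
      (isHyperbolicBasis_basisQ hp) (apply_mem_of_mem_ideal_smul_top (p.coord k) hq) ?_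
    fin_cases s <;> simp [sigma_blockIndex_zero, sigma_blockIndex_one]
  unfold eTransOIdeal
  rw [Subgroup.closure_le]
  rintro τ ⟨q, hqI, hq, h | h⟩
  · rw [isRho_iff (p := p) hB hc hq (formQ_basisQ_inl hp 1) (formQ_basisQ_inl_inr p 1 q)] at h
    rw [h]
    exact (key 1 q hqI).2
  · rw [isMu_iff (p := p) hB hc hq (formQ_basisQ_inl hp 0) (formQ_basisQ_inl_inr p 0 q)] at h
    rw [h]
    exact (key 0 q hqI).2

theorem elemGroup_le_relETransO (hp : IsHyperbolicBasis B p sigma)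
    (I : Ideal R) :
    elemGroup (formQ_symm hB) hc (basisQ p) sigma I ≤ relETransO B I := by
  have hQ := isHyperbolicBasis_basisQ hp
  have hle : eTransOIdeal B I ≤ relETransO B I := le_normalClosureIn (eTransOIdeal_le_eTransO B I)
  unfold elemGroup
  rw [Subgroup.closure_le]
  rintro τ ⟨i, j, z, hu, hv, hij, hij', hz, rfl⟩
  suffices h : z • basisQ p j ∈ siegelVectors (formQ_symm hB) hc (relETransO B I) hu from h.2
  obtain ⟨i, rfl⟩ := (blockIndex n).surjective i
  obtain ⟨j, rfl⟩ := (blockIndex n).surjective j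
  have hzz : ∀ k, formQ B (z • basisQ p k) (z • basisQ p k) = 0 := by
    intro k
    rw [map_smul, map_smul, LinearMap.smul_apply, hQ.form_self, smul_zero, smul_zero]
  rcases i with i | i <;> rcases j with j | j
  · exfalso
    fin_cases i <;> fin_cases j <;> simp_all [sigma_blockIndex_zero, sigma_blockIndex_one]
  · exact siegelVectors_mono _ _ hle _ (smul_basisQ_mem_siegelVectors hB hc hp I i j hz)
  -- Exchanging the two vectors brings the one from `ℍ(R)` to the first place.
  · rw [mem_siegelVectors_iff_neg _ _ (hzz _)]
    refine mem_siegelVectors_of_smul _ _ _ (by simpa using hu) (hu := hQ.form_self _)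
      (siegelVectors_mono _ _ hle _ ?_)
    rw [smul_neg, ← neg_smul]
    exact smul_basisQ_mem_siegelVectors hB hc hp I j i (I.neg_mem hz)
  -- Both vectors lie in `P`, and the plane `ℍ(R)` supplies the hyperbolic pair for the commutator.
  -- This produces only an element of the normal closure, even for a generator of level `I`.
  · refine mem_siegelVectors_of_commutator (formQ_symm hB) hc (eTransOIdeal_le_eTransO B I) hu
      (hzz _) hv (formQ_basisQ_inl hp 0) (formQ_basisQ_inl hp 1) (hQ.form_sigma _) ?_ ?_ ?_
      (smul_basisQ_mem_siegelVectors hB hc hp I 1 j hz)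
    · simp [basisQ_inr, basisQ_one, formQ_apply]
    · simp [basisQ_inr, basisQ_zero, formQ_apply]
    · rw [← neg_one_smul R]
      exact siegelVectors_mono _ _ (eTransOIdeal_le_eTransO B ⊤) _
        (smul_basisQ_mem_siegelVectors hB hc hp ⊤ 0 i Submodule.mem_top)

/-- The case `I = R`: it shows that both relative groups are normal closures in the same group. -/
theorem eTransO_eq_elemGroup (hp : IsHyperbolicBasis B p sigma) :
    eTransO B = elemGroup (formQ_symm hB) hc (basisQ p) sigma ⊤ := by
  apply le_antisymm
  · rw [← eTransOIdeal_top]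
    exact eTransOIdeal_le_elemGroup hB hc hp ⊤
  · exact (elemGroup_le_relETransO hB hc hp ⊤).trans (normalClosureIn_le_right _ _)

/-- The relative group of elementary orthogonal transvections is the relative elementary
group. -/
theorem relETransO_eq_relElemGroup (hp : IsHyperbolicBasis B p sigma)
    (I : Ideal R) :
    relETransO B I = relElemGroup (formQ_symm hB) hc (basisQ p) sigma I := by
  apply le_antisymm
  · refine normalClosureIn_le ((eTransOIdeal_le_elemGroup hB hc hp I).trans
      (elemGroup_le_relElemGroup _ _ I)) fun k hk x hx => ?_
    rw [eTransO_eq_elemGroup hB hc hp] at hk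
    exact conj_mem_normalClosureIn hk hx
  · refine normalClosureIn_le (elemGroup_le_relETransO hB hc hp I) fun k hk x hx => ?_
    rw [← eTransO_eq_elemGroup hB hc hp] at hk
    exact conj_mem_normalClosureIn hk hx

end ElementaryTransvections
end RelOrth

namespace RelOrth

/-! ### Passage to matrices. -/

section MatrixGroups

variable {R : Type*} [CommRing R] {M : Type*} [AddCommGroup M] [Module R M]

theorem matrixOf_val {ι : Type*} [Fintype ι] [DecidableEq ι] (f : Basis ι R M) (τ : M ≃ₗ[R] M) :
    (matrixOf f τ).val = LinearMap.toMatrix f f τ.toLinearMap := rfl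

theorem matrixOf_eq_conj {ι : Type*} [Fintype ι] [DecidableEq ι] {f g : Basis ι R M} {G : GL ι R}
    (hG : g.toMatrix f = G.val) (τ : M ≃ₗ[R] M) : matrixOf f τ = G⁻¹ * matrixOf g τ * G := by
  rw [mul_assoc, eq_inv_mul_iff_mul_eq]
  apply Units.ext
  rw [Units.val_mul, Units.val_mul, matrixOf_val, matrixOf_val, ← hG,
    basis_toMatrix_mul_linearMap_toMatrix, linearMap_toMatrix_mul_basis_toMatrix]

theorem matrixGroup_eq_map_conj {ι : Type*} [Fintype ι] [DecidableEq ι] {f g : Basis ι R M}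
    {G : GL ι R} (hG : g.toMatrix f = G.val) {B : LinearMap.BilinForm R M}
    (H : Subgroup (isometryGroup B)) :
    matrixGroup f H = (matrixGroup g H).map (MulAut.conj G⁻¹).toMonoidHom := by
  unfold matrixGroup
  simp only [Subgroup.map_map]
  congr 1
  ext1 τ
  change matrixOf f (τ : M ≃ₗ[R] M) = G⁻¹ * matrixOf g (τ : M ≃ₗ[R] M) * G⁻¹⁻¹
  rw [inv_inv, matrixOf_eq_conj hG]

variable {m : ℕ} {f : Basis (Fin (2 * m)) R M} {B : LinearMap.BilinForm R M}

theorem IsHyperbolicBasis.toMatrix_eq_psi (hf : IsHyperbolicBasis B f sigma) :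
    LinearMap.BilinForm.toMatrix f B = psi R m := by
  ext i j
  rw [LinearMap.BilinForm.toMatrix_apply, hf.form, psi, Matrix.of_apply]

theorem isHyperbolicBasis_of_toMatrix_eq_psi (h : LinearMap.BilinForm.toMatrix f B = psi R m) :
    IsHyperbolicBasis B f sigma where
  involutive := sigma_sigma
  ne := sigma_ne
  form i j := by rw [← LinearMap.BilinForm.toMatrix_apply f, h, psi, Matrix.of_apply]

theorem matrixOf_mem_orthGroup (hf : IsHyperbolicBasis B f sigma) (τ : isometryGroup B) :
    matrixOf f (τ : M ≃ₗ[R] M) ∈ orthGroup R m := by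
  change (matrixOf f (τ : M ≃ₗ[R] M)).valᵀ * psi R m * (matrixOf f (τ : M ≃ₗ[R] M)).val = psi R m
  rw [matrixOf_val, ← hf.toMatrix_eq_psi, ← LinearMap.BilinForm.toMatrix_comp]
  congr 1
  ext x y
  exact τ.2 x y

variable (hB : ∀ x y, B x y = B y x) {c : R} (hc : 2 * c = 1)

/-- Pairing with `f j` reads off the coordinate `σ j`, whence the shift of the second index. -/
theorem matrixOf_siegel (hf : IsHyperbolicBasis B f sigma) {i j : Fin (2 * m)} {z : R}
    (hu : B (f i) (f i) = 0) (hv : B (f i) (z • f j) = 0) :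
    (matrixOf f (siegel hB hc hu hv : M ≃ₗ[R] M)).val = oeMatrix i (sigma j) z := by
  ext k l
  rw [matrixOf_val, LinearMap.toMatrix_apply, LinearEquiv.coe_coe, siegel_apply]
  simp only [map_smul, LinearMap.smul_apply, hf.form_self, hf.form, map_sub, map_add,
    Finsupp.sub_apply, Finsupp.add_apply, Finsupp.smul_apply, Basis.repr_self, oeMatrix,
    sigma_sigma, Matrix.sub_apply, Matrix.add_apply, Matrix.one_apply, Matrix.single_apply,
    Finsupp.single_apply, smul_eq_mul]
  simp only [eq_comm (a := l)]
  split_ifs <;> simp_all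

theorem map_elemGroup (hf : IsHyperbolicBasis B f sigma) (I : Ideal R) :
    (elemGroup hB hc f sigma I).map ((matrixOf f).toMonoidHom.comp (isometryGroup B).subtype) =
      (eoIdeal m I).map (orthGroup R m).subtype := by
  unfold elemGroup eoIdeal
  rw [MonoidHom.map_closure, MonoidHom.map_closure]
  congr 1
  ext α
  constructor
  · rintro ⟨_, ⟨i, j, z, hu, hv, hij, hij', hz, rfl⟩, rfl⟩
    refine ⟨⟨_, matrixOf_mem_orthGroup hf (siegel hB hc hu hv)⟩,
      ⟨i, sigma j, z, hij', ?_, hz, matrixOf_siegel hB hc hf hu hv⟩, rfl⟩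
    rwa [sigma_sigma]
  · rintro ⟨α, ⟨i, j, z, hij, hij', hz, hα⟩, rfl⟩
    have hv : B (f i) (z • f (sigma j)) = 0 := by
      rw [map_smul, hf.form_of_ne, smul_zero]
      exact fun h => hij (by rw [← sigma_sigma i, ← h, sigma_sigma])
    refine ⟨siegel hB hc (hf.form_self i) hv,
      ⟨i, sigma j, z, hf.form_self i, hv, hij', ?_, hz, rfl⟩, ?_⟩
    · rwa [sigma_sigma]
    · apply Units.ext
      refine (matrixOf_siegel hB hc hf (hf.form_self i) hv).trans ?_
      rw [sigma_sigma]
      exact hα.symm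

theorem matrixGroup_relElemGroup (hf : IsHyperbolicBasis B f sigma) (I : Ideal R) :
    matrixGroup f (relElemGroup hB hc f sigma I) = (relEO m I).map (orthGroup R m).subtype := by
  have hle : eoIdeal m I ≤ eoIdeal m (⊤ : Ideal R) := by
    refine Subgroup.closure_mono ?_
    rintro α ⟨i, j, z, hij, hij', -, hα⟩
    exact ⟨i, j, z, hij, hij', Submodule.mem_top, hα⟩
  rw [matrixGroup, Subgroup.map_map, relElemGroup,
    map_normalClosureIn _ (elemGroup_mono hB hc le_top), map_elemGroup hB hc hf,
    map_elemGroup hB hc hf, relEO, map_normalClosureIn _ hle]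

end MatrixGroups

/-! ### The change of basis by `ε`. -/

section CoordinateChange

variable {R : Type*} [CommRing R] {P : Type*} [AddCommGroup P] [Module R P] {n : ℕ}

/-- The basis in which the coordinate column of `x` is `ε` times the one in the basis `b`. -/
noncomputable def coordBasis (b : Basis (Fin (2 * n)) R P) (ε : GL (Fin (2 * n)) R) :
    Basis (Fin (2 * n)) R P :=
  Basis.ofEquivFun (b.equivFun.trans (Matrix.toLin'OfInv ε.inv_mul ε.mul_inv))

theorem coordBasis_repr (b : Basis (Fin (2 * n)) R P) (ε : GL (Fin (2 * n)) R) (x : P) :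
    ⇑((coordBasis b ε).repr x) = ε.val *ᵥ ⇑(b.repr x) := by
  ext i
  simp [coordBasis]

theorem coordBasis_toMatrix (b : Basis (Fin (2 * n)) R P) (ε : GL (Fin (2 * n)) R) :
    (coordBasis b ε).toMatrix b = ε.val := by
  ext i j
  rw [Basis.toMatrix_apply, coordBasis_repr, Basis.repr_self, Finsupp.single_eq_pi_single,
    Matrix.mulVec_single_one]
  rfl

theorem isHyperbolicBasis_coordBasis {b : Basis (Fin (2 * n)) R P} {ε : GL (Fin (2 * n)) R}
    {B : LinearMap.BilinForm R P}
    (h : LinearMap.BilinForm.toMatrix b B = ε.valᵀ * psi R n * ε.val) :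
    IsHyperbolicBasis B (coordBasis b ε) sigma := by
  apply isHyperbolicBasis_of_toMatrix_eq_psi
  have h1 : ε.val * b.toMatrix (coordBasis b ε) = 1 := by
    rw [← coordBasis_toMatrix b ε, Basis.toMatrix_mul_toMatrix_flip]
  have h2 : (b.toMatrix (coordBasis b ε))ᵀ * ε.valᵀ = 1 := by
    rw [← Matrix.transpose_mul, h1, Matrix.transpose_one]
  rw [← LinearMap.BilinForm.toMatrix_mul_basis_toMatrix b, h]
  calc _ = ((b.toMatrix (coordBasis b ε))ᵀ * ε.valᵀ) * psi R n *
        (ε.val * b.toMatrix (coordBasis b ε)) := by simp only [Matrix.mul_assoc]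
    _ = _ := by rw [h1, h2, Matrix.one_mul, Matrix.mul_one]

theorem basisQ_coordBasis_toMatrix (b : Basis (Fin (2 * n)) R P) (ε : GL (Fin (2 * n)) R) :
    (basisQ (coordBasis b ε)).toMatrix (basisQ b) = (onePerp ε).val := by
  ext i j
  obtain ⟨i, rfl⟩ := (blockIndex n).surjective i
  obtain ⟨j, rfl⟩ := (blockIndex n).surjective j
  have h := fun i j => congrFun (congrFun (coordBasis_toMatrix b ε) i) j
  simp only [Basis.toMatrix_apply] at h
  rcases i with i | i <;> rcases j with j | j <;>
    simp [Basis.toMatrix_apply, basisQ, onePerp, h, Matrix.one_apply, Finsupp.single_apply,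
      eq_comm]

end CoordinateChange
end RelOrth

theorem mainTheorem5 {R : Type*} [CommRing R] (h2 : IsUnit (2 : R)) (I : Ideal R)
    (n : ℕ) (hn : 2 ≤ n) {P : Type*} [AddCommGroup P] [Module R P]
    (b : Module.Basis (Fin (2 * n)) R P)
    (B : LinearMap.BilinForm R P) (hB : RelOrth.IsSymmInnerProduct B)
    (ε : Matrix.GeneralLinearGroup (Fin (2 * n)) R)
    (hφ : LinearMap.BilinForm.toMatrix b B =
      Matrix.transpose ε.val * RelOrth.psi R n * ε.val) :
    RelOrth.relTransO (RelOrth.formQ B) I = RelOrth.relETransO B I ∧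
    RelOrth.matrixGroup (RelOrth.basisQ b) (RelOrth.relTransO (RelOrth.formQ B) I) =
      ((RelOrth.relEO (n + 1) I).map (RelOrth.orthGroup R (n + 1)).subtype).map
        (MulAut.conj (RelOrth.onePerp ε)⁻¹).toMonoidHom ∧
    RelOrth.matrixGroup (RelOrth.basisQ b) (RelOrth.relETransO B I) =
      ((RelOrth.relEO (n + 1) I).map (RelOrth.orthGroup R (n + 1)).subtype).map
        (MulAut.conj (RelOrth.onePerp ε)⁻¹).toMonoidHom := by
  obtain ⟨c, hc⟩ := h2.exists_right_inv
  have hp := RelOrth.isHyperbolicBasis_coordBasis hφ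
  have hQ := RelOrth.isHyperbolicBasis_basisQ hp
  have hE := RelOrth.relETransO_eq_relElemGroup hB.symm hc hp I
  have hT := RelOrth.relTransO_eq_relElemGroup (RelOrth.formQ_symm hB.symm) hc hQ
    (RelOrth.exists_ne_sigma (by omega)) I
  have hM : RelOrth.matrixGroup (RelOrth.basisQ b) (RelOrth.relETransO B I) =
      ((RelOrth.relEO (n + 1) I).map (RelOrth.orthGroup R (n + 1)).subtype).map
        (MulAut.conj (RelOrth.onePerp ε)⁻¹).toMonoidHom := by
    rw [RelOrth.matrixGroup_eq_map_conj (RelOrth.basisQ_coordBasis_toMatrix b ε), hE,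
      RelOrth.matrixGroup_relElemGroup _ _ hQ]
  have hTE := hT.trans hE.symm
  exact ⟨hTE, by rw [hTE, hM], hM⟩
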